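/- For $n \ge 1$ let $D_n$ be the dumbbell graph on $2n$ nodes: the disjoint union of two cliques on $n$ nodes each, together with a single bridge edge joining one node of the first clique to one node of the second. The averaging process on a finite connected graph $G=(V,E)$ with initial vector $v(0)\in\mathbb R^V$ picks, in each step $t=1,2,\ldots$, an edge of $G$ uniformly at random and independently of the past, and replaces the values at both end points of this edge by their average; $v(t)$ is the resulting vector after $t$ steps, and $\bar v$ is the constant vector each of whose entries is $\frac{1}{|V|}\sum_{i\in V} v_i(0)$. The $L^1$ $\epsilon$-mixing time of $G$ is $$t_{\epsilon,1}(G)=\min\bigl\{t\in\mathbb N \;\bigm|\; \mathbb E\,\lVert v(t)-\bar v\rVert_1\le\epsilon \text{ for every } v(0) \text{ with } \lVert v(0)\rVert_1=1\bigr\},\qquad \lVert w\rVert_1=\sum_i |w_i| .$$ **Theorem.** For every $\epsilon$ with $0<\epsilon<1$ there are constants $c_\epsilon, C_\epsilon>0$, depending only on $\epsilon$, such that for every $n\ge1$ the mixing time $t_{\epsilon,1}(D_n)$ exists (the set above is non-empty) and $$c_\epsilon\, n^3\;\le\; t_{\epsilon,1}(D_n)\;\le\; C_\epsilon\, n^3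 .$$ -/

import Mathlib

namespace AveragingProcess

open MeasureTheory ProbabilityTheory

variable {V : Type*} [Fintype V] [DecidableEq V]

/-- Replace the values at both end points of the edge `e` by their average. -/
noncomputable def avgStep (e : Sym2 V) (v : V → ℝ) : V → ℝ :=
  Sym2.lift ⟨fun i j x => if x = i ∨ x = j then (v i + v j) / 2 else v x, by
    intro i j
    funext x
    simp only [or_comm, add_comm]⟩ e

/-- The state after `t` steps when the process starts at `v₀` and the edge `ω s` is the one used
in step `s + 1`. -/
noncomputable def state (v₀ : V → ℝ) (ω : ℕ → Sym2 V) : ℕ → V → ℝ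
  | 0 => v₀
  | t + 1 => avgStep (ω t) (state v₀ ω t)

/-- The constant vector whose entries are the mean of the entries of `v₀`. -/
noncomputable def meanVec (v₀ : V → ℝ) : V → ℝ :=
  fun _ => (∑ i, v₀ i) / (Fintype.card V : ℝ)

/-- The `L¹` norm of a vector. -/
def l1Norm (v : V → ℝ) : ℝ := ∑ i, |v i|

/-- Unordered pairs carry the discrete sigma-algebra. -/
instance instMeasurableSpaceSym2 : MeasurableSpace (Sym2 V) := ⊤

/-- The law of the sequence of chosen edges: independent, each uniform on the edge set of `G`
(for a graph with at least one edge). -/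
noncomputable def edgeLaw (G : SimpleGraph V) : Measure (ℕ → Sym2 V) :=
  Measure.infinitePi fun _ : ℕ => uniformOn G.edgeSet

/-- The expected `L¹` distance `𝔼 ‖v(t) - v̄‖₁` of the averaging process on `G` started at `v₀`. -/
noncomputable def expectedL1Dist (G : SimpleGraph V) (v₀ : V → ℝ) (t : ℕ) : ℝ :=
  ∫ ω, l1Norm (state v₀ ω t - meanVec v₀) ∂(edgeLaw G)

/-- The times `t` at which every start on the unit `L¹` sphere has expected `L¹` distance at most
`ε` from its mean vector. -/
def mixedTimes (ε : ℝ) (G : SimpleGraph V) : Set ℕ :=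
  {t | ∀ v₀ : V → ℝ, l1Norm v₀ = 1 → expectedL1Dist G v₀ t ≤ ε}

/-- The `L¹` `ε`-mixing time: the least element of `mixedTimes ε G` (when there is one). -/
noncomputable def mixingTime (ε : ℝ) (G : SimpleGraph V) : ℕ :=
  sInf (mixedTimes ε G)

/-- The dumbbell graph on `2 n` nodes: two disjoint cliques on `n` nodes each, and one bridge edge
joining the last node of the first clique to the last node of the second clique. -/
def dumbbell (n : ℕ) : SimpleGraph (Fin n ⊕ Fin n) where
  Adj
    | .inl i, .inl j => i ≠ j
    | .inr i, .inr j => i ≠ j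
    | .inl i, .inr j => (i : ℕ) + 1 = n ∧ (j : ℕ) + 1 = n
    | .inr i, .inl j => (i : ℕ) + 1 = n ∧ (j : ℕ) + 1 = n
  symm := ⟨by
    rintro (i | i) (j | j) h
    · exact Ne.symm h
    · exact And.symm h
    · exact And.symm h
    · exact Ne.symm h⟩
  loopless := ⟨by
    rintro (i | i) h
    · exact h rfl
    · exact h rfl⟩

end AveragingProcess

namespace AveragingProcess

open MeasureTheory ProbabilityTheory Finset

/-! ### The averaging step, the Markov property, and sums over edges. -/

section General

/-! The bottleneck is the bridge: it is picked about once in `n ^ 2` steps, and one use shifts mass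
of order `1 / n` at most when the entries are of order `1 / n`.

Lower bound: from the uniform vector on one clique all entries stay in `[0, 1 / n]`, so the mean
imbalance between the cliques falls by at most `1 / (n * numEdges n)` per step, and the imbalance
bounds the `L¹` distance from below (`one_sub_le_expectedL1Dist`).

Upper bound: the squared distance to the mean splits into the variance inside the cliques and
`imbalance ^ 2 / (2 * n)`. It contracts by a factor `1 - 1 / (8 * n ^ 3)` per step
(`sqDist_drift_le`), but Cauchy-Schwarz against `L¹` costs a factor `2 * n`, so contraction from the
initial bound `1` would give `n ^ 3 * log n`. The logarithm is removed by a burn-in of `2 * n ^ 2`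
steps: the variance inside the cliques decays at the faster rate `1 / (2 * n)`
(`cliqueSqDist_drift_le`), which leaves an expected squared distance of order `1 / n`
(`integral_sqDist_le_of_phase`). Order `n ^ 3` further steps then suffice. -/

lemma isProbabilityMeasure_uniformOn_edgeSet {V : Type*} [Finite V] {G : SimpleGraph V}
    (hG : G.edgeSet.Nonempty) : IsProbabilityMeasure (uniformOn G.edgeSet) :=
  isProbabilityMeasure_uniformOn' (Set.toFinite _) hG trivial

lemma isProbabilityMeasure_edgeLaw {V : Type*} [Finite V] {G : SimpleGraph V} (hG : G.edgeSet.Nonempty) :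
    IsProbabilityMeasure (edgeLaw G) := by
  have := isProbabilityMeasure_uniformOn_edgeSet hG
  unfold edgeLaw
  infer_instance

variable {V : Type*} [DecidableEq V]

lemma avgStep_mk (i j : V) (v : V → ℝ) :
    avgStep s(i, j) v = fun x => if x = i ∨ x = j then (v i + v j) / 2 else v x := rfl

lemma avgStep_diag (i : V) (v : V → ℝ) : avgStep s(i, i) v = v := by
  funext x
  rw [avgStep_mk]
  by_cases h : x = i
  · subst h; simp
  · simp [h]

lemma state_invariant {P : (V → ℝ) → Prop} (hP : ∀ e v, P v → P (avgStep e v)) {v₀ : V → ℝ}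
    (h₀ : P v₀) (ω : ℕ → Sym2 V) (t : ℕ) : P (state v₀ ω t) := by
  induction t with
  | zero => exact h₀
  | succ t ih => exact hP _ _ ih

lemma state_congr (v₀ : V → ℝ) {ω ω' : ℕ → Sym2 V} {t : ℕ} (h : ∀ s < t, ω s = ω' s) :
    state v₀ ω t = state v₀ ω' t := by
  induction t with
  | zero => rfl
  | succ t ih =>
    simp only [state]
    rw [ih fun s hs => h s (by omega), h t (by omega)]

lemma avgStep_mem_Icc {a b : ℝ} (e : Sym2 V) (v : V → ℝ) (h : ∀ x, v x ∈ Set.Icc a b) (x : V) :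
    avgStep e v x ∈ Set.Icc a b := by
  induction e with
  | _ i j =>
    rw [avgStep_mk]
    have hi := h i
    have hj := h j
    simp only [Set.mem_Icc] at hi hj ⊢
    split_ifs
    · constructor <;> linarith
    · exact h x

/-- The state at time `t` is a function of the first `t` edges. -/
lemma exists_state_eq_comp (e₀ : Sym2 V) (v₀ : V → ℝ) (t : ℕ) :
    ∃ F : (range t → Sym2 V) → V → ℝ, ∀ ω, state v₀ ω t = F fun i => ω i := by
  -- `e₀` only fills the times from `t` on, which the state at time `t` never reads.
  refine ⟨fun u => state v₀ (fun s => if hs : s ∈ range t then u ⟨s, hs⟩ else e₀) t, fun ω => ?_⟩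
  apply state_congr
  intro s hs
  simp [hs]

variable [Fintype V]

/-- Averaging over an edge changes a sum of a function of the entries only at the two ends. -/
lemma sum_avgStep {i j : V} (hij : i ≠ j) (v : V → ℝ) (φ : V → ℝ → ℝ) :
    ∑ x, φ x (avgStep s(i, j) v x) = ∑ x, φ x (v x)
      + (φ i ((v i + v j) / 2) - φ i (v i)) + (φ j ((v i + v j) / 2) - φ j (v j)) := by
  have h : ∀ x, φ x (avgStep s(i, j) v x) = φ x (v x)
      + (if x = i then φ i ((v i + v j) / 2) - φ i (v i) else 0)
      + (if x = j then φ j ((v i + v j) / 2) - φ j (v j) else 0) := by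
    intro x
    rw [avgStep_mk]
    by_cases h1 : x = i
    · subst h1; simp [hij]
    · by_cases h2 : x = j
      · subst h2; simp [h1]
      · simp [h1, h2]
  simp only [h, sum_add_distrib, sum_ite_eq', mem_univ, if_true]

lemma l1Norm_avgStep_le (e : Sym2 V) (v : V → ℝ) : l1Norm (avgStep e v) ≤ l1Norm v := by
  induction e with
  | _ i j =>
    by_cases hij : i = j
    · subst hij; rw [avgStep_diag]
    · unfold l1Norm
      rw [sum_avgStep hij v fun _ y => |y|]
      have : |(v i + v j) / 2| ≤ (|v i| + |v j|) / 2 := by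
        rw [abs_div, abs_two]
        gcongr
        exact abs_add_le _ _
      linarith

lemma sum_avgStep_eq (e : Sym2 V) (v : V → ℝ) : ∑ x, avgStep e v x = ∑ x, v x := by
  induction e with
  | _ i j =>
    by_cases hij : i = j
    · subst hij; rw [avgStep_diag]
    · rw [sum_avgStep hij v fun _ y => y]; ring

variable {G : SimpleGraph V}

instance instMeasurableSingletonClassSym2 : MeasurableSingletonClass (Sym2 V) := ⟨fun _ => trivial⟩

/-- The state factors through finitely many edges, hence through a finite space, so `f` need not be
measurable. -/
lemma integrable_state (hG : G.edgeSet.Nonempty) (v₀ : V → ℝ) (t : ℕ) (f : (V → ℝ) → ℝ) :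
    Integrable (fun ω => f (state v₀ ω t)) (edgeLaw G) := by
  have := isProbabilityMeasure_edgeLaw hG
  obtain ⟨F, hF⟩ := exists_state_eq_comp hG.some v₀ t
  simp only [hF]
  have hm : Measurable fun (ω : ℕ → Sym2 V) (i : range t) => ω i := by fun_prop
  exact (Integrable.of_finite (f := fun u => f (F u))
    (μ := (edgeLaw G).map fun ω (i : range t) => ω i)).comp_measurable hm

/-- The Markov property of the averaging process. -/
lemma integral_state_succ (hG : G.edgeSet.Nonempty) (v₀ : V → ℝ) (t : ℕ) (f : (V → ℝ) → ℝ) :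
    ∫ ω, f (state v₀ ω (t + 1)) ∂(edgeLaw G)
      = ∫ ω, ∫ e, f (avgStep e (state v₀ ω t)) ∂(uniformOn G.edgeSet) ∂(edgeLaw G) := by
  have := isProbabilityMeasure_edgeLaw hG
  have hu := isProbabilityMeasure_uniformOn_edgeSet hG
  obtain ⟨F, hF⟩ := exists_state_eq_comp hG.some v₀ t
  have hind : iIndepFun (fun (s : ℕ) (ω : ℕ → Sym2 V) => ω s) (edgeLaw G) :=
    iIndepFun_infinitePi (P := fun _ : ℕ => uniformOn G.edgeSet) (X := fun _ e => e)
      (fun _ => measurable_id)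
  have hind2 := hind.indepFun_finset (range t) {t} (by simp) (fun i => by fun_prop)
  -- The edge at time `t` is independent of the earlier edges, which determine the state.
  have hfac : ∀ e : Sym2 V,
      ∫ ω, (if ω t = e then 1 else 0) * f (avgStep e (state v₀ ω t)) ∂(edgeLaw G)
        = (uniformOn G.edgeSet).real {e} * ∫ ω, f (avgStep e (state v₀ ω t)) ∂(edgeLaw G) := by
    intro e
    have h1 : Measurable fun u : range t → Sym2 V => f (avgStep e (F u)) := measurable_of_finite _
    have h2 : Measurable fun u : ({t} : Finset ℕ) → Sym2 V =>
        if u ⟨t, by simp⟩ = e then (1 : ℝ) else 0 := measurable_of_finite _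
    have h3 := (hind2.comp h1 h2).symm
    have hm1 : Measurable fun (ω : ℕ → Sym2 V) (i : range t) => ω i := by fun_prop
    have hm2 : Measurable fun (ω : ℕ → Sym2 V) (i : ({t} : Finset ℕ)) => ω i := by fun_prop
    have h4 := h3.integral_fun_mul_eq_mul_integral
      (h2.comp hm2).aestronglyMeasurable (h1.comp hm1).aestronglyMeasurable
    simp only [Function.comp_def] at h4
    simp only [hF]
    rw [h4]
    congr 1
    have hp : MeasurePreserving (Function.eval t) (edgeLaw G) (uniformOn G.edgeSet) :=
      measurePreserving_eval_infinitePi (fun _ : ℕ => uniformOn G.edgeSet) t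
    have h5 := integral_map (μ := edgeLaw G) hp.measurable.aemeasurable
      (f := fun x : Sym2 V => if x = e then (1 : ℝ) else 0)
      (measurable_of_finite _).aestronglyMeasurable
    rw [hp.map_eq, integral_fintype Integrable.of_finite] at h5
    simpa using h5.symm
  calc ∫ ω, f (state v₀ ω (t + 1)) ∂(edgeLaw G)
      = ∫ ω, ∑ e, (if ω t = e then 1 else 0) * f (avgStep e (state v₀ ω t)) ∂(edgeLaw G) := by
        simp [state]
    _ = ∑ e, ∫ ω, (if ω t = e then 1 else 0) * f (avgStep e (state v₀ ω t)) ∂(edgeLaw G) := by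
        apply integral_finsetSum
        intro e _
        refine (integrable_state hG v₀ t fun v => f (avgStep e v)).bdd_mul (c := 1) ?_ ?_
        · exact ((measurable_of_finite fun x : Sym2 V => if x = e then (1 : ℝ) else 0).comp
            (measurable_pi_apply t)).aestronglyMeasurable
        · refine Filter.Eventually.of_forall fun ω => ?_
          split_ifs <;> simp
    _ = ∑ e, ∫ ω, (uniformOn G.edgeSet).real {e} * f (avgStep e (state v₀ ω t)) ∂(edgeLaw G) := by
        simp only [hfac, integral_const_mul]
    _ = _ := by
        rw [← integral_finsetSum]
        · simp only [integral_fintype Integrable.of_finite, smul_eq_mul]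
        · intro e _
          exact (integrable_state hG v₀ t fun v => f (avgStep e v)).const_mul _

/-- A one-step drift inequality on an invariant set of vectors integrates. -/
lemma integral_state_succ_le (hG : G.edgeSet.Nonempty) {P : (V → ℝ) → Prop}
    (hP : ∀ e v, P v → P (avgStep e v)) {v₀ : V → ℝ} (h₀ : P v₀) (f : (V → ℝ) → ℝ) (a b : ℝ)
    (hf : ∀ v, P v → ∫ e, f (avgStep e v) ∂(uniformOn G.edgeSet) ≤ a * f v + b) (t : ℕ) :
    ∫ ω, f (state v₀ ω (t + 1)) ∂(edgeLaw G)
      ≤ a * (∫ ω, f (state v₀ ω t) ∂(edgeLaw G)) + b := by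
  have := isProbabilityMeasure_edgeLaw hG
  have hi := integrable_state hG v₀ t f
  calc _ = _ := integral_state_succ hG v₀ t f
    _ ≤ ∫ ω, a * f (state v₀ ω t) + b ∂(edgeLaw G) := by
        apply integral_mono
          (integrable_state hG v₀ t fun v => ∫ e, f (avgStep e v) ∂(uniformOn G.edgeSet))
          ((hi.const_mul a).add (integrable_const b))
        exact fun ω => hf _ (state_invariant hP h₀ ω t)
    _ = _ := by
        rw [integral_add (hi.const_mul a) (integrable_const b), integral_const_mul]
        simp

/-- Twice a sum over the edges is the sum over ordered pairs of adjacent vertices. -/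
lemma two_mul_sum_edgeFinset [DecidableRel G.Adj] (g : Sym2 V → ℝ) :
    2 * ∑ e ∈ G.edgeFinset, g e = ∑ i, ∑ j, if G.Adj i j then g s(i, j) else 0 := by
  -- Each edge carries exactly two darts.
  have h1 : ∑ e ∈ G.edgeFinset, ∑ d : G.Dart with d.edge = e, g d.edge
      = ∑ d : G.Dart, g d.edge :=
    sum_fiberwise_of_maps_to (fun d _ => by simp) _
  have h2 : ∑ e ∈ G.edgeFinset, ∑ d : G.Dart with d.edge = e, g d.edge
      = ∑ e ∈ G.edgeFinset, 2 * g e := by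
    refine sum_congr rfl fun e he => ?_
    rw [sum_congr rfl (g := fun _ => g e) fun d hd => by rw [(mem_filter.1 hd).2], sum_const,
      G.dart_edge_fiber_card e (by simpa using he)]
    simp
  rw [mul_sum, ← h2, h1, ← sum_product', univ_product_univ, ← sum_filter]
  refine sum_bij (fun d _ => d.toProd) (fun d _ => by simp)
    (fun d _ d' _ h => SimpleGraph.Dart.ext _ _ h)
    (fun p hp => ⟨⟨p, by simpa using hp⟩, mem_univ _, rfl⟩) (fun d _ => rfl)

lemma card_mul_integral_uniformOn_edgeSet [DecidableRel G.Adj] (hG : G.edgeSet.Nonempty)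
    (g : Sym2 V → ℝ) :
    (#G.edgeFinset : ℝ) * ∫ e, g e ∂(uniformOn G.edgeSet) = ∑ e ∈ G.edgeFinset, g e := by
  have hu := isProbabilityMeasure_uniformOn_edgeSet hG
  have hne : (#G.edgeFinset : ℝ) ≠ 0 := by
    simpa [Set.nonempty_iff_ne_empty] using hG
  rw [integral_fintype Integrable.of_finite, mul_sum]
  have h : ∀ e, (uniformOn G.edgeSet).real {e}
      = if e ∈ G.edgeFinset then (#G.edgeFinset : ℝ)⁻¹ else 0 := by
    intro e
    rw [Measure.real, ← G.coe_edgeFinset, ← coe_singleton, uniformOn_apply_finset]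
    split_ifs with he
    · rw [inter_singleton_of_mem he]; simp
    · rw [inter_singleton_of_notMem he]; simp
  simp only [h, smul_eq_mul, ite_mul, zero_mul, mul_ite, mul_zero, mul_inv_cancel_left₀ hne]
  rw [← sum_filter, filter_mem_eq_inter, univ_inter]

end General
-- Edges of the dumbbell graph and one-step drift.
section Dumbbell

variable {n : ℕ}

lemma dumbbell_edgeSet_nonempty (hn : 1 ≤ n) : (dumbbell n).edgeSet.Nonempty := by
  refine ⟨s(.inl ⟨n - 1, by omega⟩, .inr ⟨n - 1, by omega⟩), ?_⟩
  rw [SimpleGraph.mem_edgeSet]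
  constructor <;> simp <;> omega

lemma two_mul_sum_dumbbell [DecidableRel (dumbbell n).Adj] {p : Fin n} (hp : (p : ℕ) + 1 = n)
    (g : Sym2 (Fin n ⊕ Fin n) → ℝ) :
    2 * ∑ e ∈ (dumbbell n).edgeFinset, g e
      = (∑ i : Fin n, ∑ j, if i = j then 0 else g s(.inl i, .inl j))
        + (∑ i : Fin n, ∑ j, if i = j then 0 else g s(.inr i, .inr j))
        + 2 * g s(.inl p, .inr p) := by
  have hp' : ∀ i : Fin n, (i : ℕ) + 1 = n ↔ i = p := fun i => by rw [Fin.ext_iff]; omega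
  have hll : ∀ i j : Fin n, (dumbbell n).Adj (.inl i) (.inl j) ↔ ¬ i = j := fun _ _ => Iff.rfl
  have hrr : ∀ i j : Fin n, (dumbbell n).Adj (.inr i) (.inr j) ↔ ¬ i = j := fun _ _ => Iff.rfl
  have hlr : ∀ i j : Fin n, (dumbbell n).Adj (.inl i) (.inr j) ↔ i = p ∧ j = p := fun i j => by
    rw [← hp' i, ← hp' j]; rfl
  have hrl : ∀ i j : Fin n, (dumbbell n).Adj (.inr i) (.inl j) ↔ i = p ∧ j = p := fun i j => by
    rw [← hp' i, ← hp' j]; rfl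
  rw [two_mul_sum_edgeFinset]
  simp only [Fintype.sum_sum_type, hll, hrr, hlr, hrl, ite_and, sum_add_distrib, ite_not,
    sum_ite_irrel, sum_const_zero, sum_ite_eq', mem_univ, if_true]
  rw [Sym2.eq_swap (a := Sum.inr p)]
  ring

/-- The number of edges of the dumbbell graph. -/
def numEdges (n : ℕ) : ℝ := (n : ℝ) * (n - 1) + 1

lemma card_edgeFinset_dumbbell [DecidableRel (dumbbell n).Adj] (hn : 1 ≤ n) :
    (#(dumbbell n).edgeFinset : ℝ) = numEdges n := by
  have h := two_mul_sum_dumbbell (n := n) (p := ⟨n - 1, by omega⟩) (by simp; omega) fun _ => 1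
  have h2 : ∀ i : Fin n, ∑ j : Fin n, (if i = j then (0 : ℝ) else 1) = n - 1 := by
    intro i
    have : ∀ j : Fin n, (if i = j then (0 : ℝ) else 1) = 1 - if i = j then 1 else 0 := by
      intro j; split_ifs <;> simp
    simp [this]
  simp only [h2] at h
  simp only [sum_const, card_univ, Fintype.card_fin, nsmul_eq_mul, mul_one] at h
  unfold numEdges
  linarith

lemma one_le_numEdges (hn : 1 ≤ n) : 1 ≤ numEdges n := by
  have : (1 : ℝ) ≤ n := by exact_mod_cast hn
  unfold numEdges
  nlinarith

lemma numEdges_le (hn : 1 ≤ n) : numEdges n ≤ (n : ℝ) ^ 2 := by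
  have : (1 : ℝ) ≤ n := by exact_mod_cast hn
  unfold numEdges
  nlinarith

lemma sq_le_two_mul_numEdges (n : ℕ) : (n : ℝ) ^ 2 ≤ 2 * numEdges n := by
  unfold numEdges
  nlinarith [sq_nonneg ((n : ℝ) - 1)]

/-- The expected one-step change of a function of the vector. -/
lemma two_mul_numEdges_mul_drift {p : Fin n} (hp : (p : ℕ) + 1 = n)
    (f : (Fin n ⊕ Fin n → ℝ) → ℝ) (v : Fin n ⊕ Fin n → ℝ) :
    2 * numEdges n * (∫ e, f (avgStep e v) ∂(uniformOn (dumbbell n).edgeSet) - f v)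
      = (∑ i : Fin n, ∑ j, (f (avgStep s(.inl i, .inl j) v) - f v))
        + (∑ i : Fin n, ∑ j, (f (avgStep s(.inr i, .inr j) v) - f v))
        + 2 * (f (avgStep s(.inl p, .inr p) v) - f v) := by
  classical
  have hn : 1 ≤ n := by omega
  have hG := dumbbell_edgeSet_nonempty hn
  have := isProbabilityMeasure_uniformOn_edgeSet hG
  have h1 : ∫ e, f (avgStep e v) ∂(uniformOn (dumbbell n).edgeSet) - f v
      = ∫ e, (f (avgStep e v) - f v) ∂(uniformOn (dumbbell n).edgeSet) := by
    rw [integral_sub Integrable.of_finite Integrable.of_finite]; simp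
  rw [h1, ← card_edgeFinset_dumbbell hn, mul_assoc, card_mul_integral_uniformOn_edgeSet hG,
    two_mul_sum_dumbbell hp]
  -- Diagonal terms may be included because averaging over a loop changes nothing.
  congr 2 <;>
  · refine sum_congr rfl fun i _ => sum_congr rfl fun j _ => ?_
    split_ifs with h
    · rw [h, avgStep_diag, sub_self]
    · rfl

/-! ### Imbalance and the decomposition of the squared distance. -/

/-- The sign telling the two cliques apart. -/
def side : Fin n ⊕ Fin n → ℝ := Sum.elim (fun _ => 1) fun _ => -1

/-- The mass of the first clique minus the mass of the second. -/
def imbalance (v : Fin n ⊕ Fin n → ℝ) : ℝ := ∑ x, side x * v x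

/-- The squared Euclidean distance to the mean vector. -/
noncomputable def sqDist (v : Fin n ⊕ Fin n → ℝ) : ℝ :=
  ∑ x, v x ^ 2 - (∑ x, v x) ^ 2 / (2 * n)

/-- The squared Euclidean distance to the vector of clique means. -/
noncomputable def cliqueSqDist (v : Fin n ⊕ Fin n → ℝ) : ℝ :=
  sqDist v - imbalance v ^ 2 / (2 * n)

lemma imbalance_eq (v : Fin n ⊕ Fin n → ℝ) :
    imbalance v = ∑ i, v (.inl i) - ∑ i, v (.inr i) := by
  simp [imbalance, side, sub_eq_add_neg]

lemma abs_imbalance_le (v : Fin n ⊕ Fin n → ℝ) : |imbalance v| ≤ l1Norm v := by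
  refine (abs_sum_le_sum_abs _ _).trans (sum_le_sum fun x _ => ?_)
  rw [abs_mul]
  rcases x with x | x <;> simp [side]

lemma imbalance_avgStep (i j : Fin n ⊕ Fin n) (v : Fin n ⊕ Fin n → ℝ) :
    imbalance (avgStep s(i, j) v) = imbalance v - (side i - side j) * (v i - v j) / 2 := by
  by_cases hij : i = j
  · subst hij; rw [avgStep_diag]; ring
  · unfold imbalance
    rw [sum_avgStep hij v fun x y => side x * y]
    ring

lemma sqDist_avgStep (i j : Fin n ⊕ Fin n) (v : Fin n ⊕ Fin n → ℝ) :
    sqDist (avgStep s(i, j) v) = sqDist v - (v i - v j) ^ 2 / 2 := by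
  by_cases hij : i = j
  · subst hij; rw [avgStep_diag]; ring
  · unfold sqDist
    rw [sum_avgStep hij v fun _ y => y ^ 2, sum_avgStep_eq]
    ring

lemma sum_sum_sub_sq (x : Fin n → ℝ) :
    ∑ i, ∑ j, (x i - x j) ^ 2 = 2 * (n * ∑ i, x i ^ 2 - (∑ i, x i) ^ 2) := by
  simp only [sub_sq, sum_add_distrib, sum_sub_distrib, ← mul_sum, ← sum_mul, sum_const, card_univ,
    Fintype.card_fin, nsmul_eq_mul]
  ring

lemma cliqueSqDist_eq (v : Fin n ⊕ Fin n → ℝ) :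
    cliqueSqDist v = (∑ i, v (.inl i) ^ 2 - (∑ i, v (.inl i)) ^ 2 / n)
      + (∑ i, v (.inr i) ^ 2 - (∑ i, v (.inr i)) ^ 2 / n) := by
  rw [cliqueSqDist, sqDist, imbalance_eq]
  simp only [Fintype.sum_sum_type]
  ring

lemma sum_sum_sub_sq_add (hn : 1 ≤ n) (v : Fin n ⊕ Fin n → ℝ) :
    (∑ i : Fin n, ∑ j : Fin n, (v (.inl i) - v (.inl j)) ^ 2)
      + (∑ i : Fin n, ∑ j : Fin n, (v (.inr i) - v (.inr j)) ^ 2) = 2 * n * cliqueSqDist v := by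
  have : (n : ℝ) ≠ 0 := by positivity
  rw [sum_sum_sub_sq fun i => v (.inl i), sum_sum_sub_sq fun i => v (.inr i), cliqueSqDist_eq]
  field_simp

lemma sub_mean_sq_le (p : Fin n) (x : Fin n → ℝ) :
    (x p - (∑ i, x i) / n) ^ 2 ≤ ∑ i, x i ^ 2 - (∑ i, x i) ^ 2 / n := by
  have hn : (n : ℝ) ≠ 0 := by have := p.pos; positivity
  have h : ∑ i, (x i - (∑ k, x k) / n) ^ 2 = ∑ i, x i ^ 2 - (∑ i, x i) ^ 2 / n := by
    simp only [sub_sq, sum_add_distrib, sum_sub_distrib, ← mul_sum, ← sum_mul, sum_const, card_univ,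
      Fintype.card_fin, nsmul_eq_mul]
    field_simp
    ring
  rw [← h]
  exact single_le_sum (f := fun i => (x i - (∑ k, x k) / n) ^ 2) (fun i _ => sq_nonneg _)
    (mem_univ p)

/-- `imbalance v / n` is the difference of the clique means, and each bridge end deviates from its
clique mean by at most the root of that clique's sum of squared deviations. -/
lemma bridge_sub_sq_le (p : Fin n) (v : Fin n ⊕ Fin n → ℝ) :
    (v (.inl p) - v (.inr p) - imbalance v / n) ^ 2 ≤ 2 * cliqueSqDist v := by
  rw [cliqueSqDist_eq, imbalance_eq]
  have h1 := sub_mean_sq_le p fun i => v (.inl i)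
  have h2 := sub_mean_sq_le p fun i => v (.inr i)
  rw [sub_div]
  nlinarith [sq_nonneg ((v (.inl p) - (∑ i, v (.inl i)) / n) + (v (.inr p) - (∑ i, v (.inr i)) / n))]

lemma cliqueSqDist_nonneg (hn : 1 ≤ n) (v : Fin n ⊕ Fin n → ℝ) : 0 ≤ cliqueSqDist v := by
  have h := bridge_sub_sq_le ⟨0, hn⟩ v
  nlinarith [sq_nonneg (v (.inl ⟨0, hn⟩) - v (.inr ⟨0, hn⟩) - imbalance v / n)]

/-! ### Contraction of the squared distances. -/

lemma cliqueSqDist_drift_le (hn : 1 ≤ n) (v : Fin n ⊕ Fin n → ℝ) (hv : l1Norm v ≤ 1) :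
    ∫ e, cliqueSqDist (avgStep e v) ∂(uniformOn (dumbbell n).edgeSet)
      ≤ (1 - 1 / (2 * n)) * cliqueSqDist v + 1 / (2 * (n : ℝ) ^ 2) := by
  have hn0 : (0 : ℝ) < n := by positivity
  have hp : ((⟨n - 1, by omega⟩ : Fin n) : ℕ) + 1 = n := by simp; omega
  have h := two_mul_numEdges_mul_drift hp cliqueSqDist v
  have hX := cliqueSqDist_nonneg hn v
  have hN1 := one_le_numEdges hn
  have hN2 := numEdges_le hn
  have hd : imbalance v ^ 2 ≤ 1 := by
    rw [sq_le_one_iff_abs_le_one]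
    exact (abs_imbalance_le v).trans hv
  set p : Fin n := ⟨n - 1, by omega⟩
  have hsum := sum_sum_sub_sq_add hn v
  have hl : ∀ i j : Fin n, cliqueSqDist (avgStep s(.inl i, .inl j) v) - cliqueSqDist v
      = -((v (.inl i) - v (.inl j)) ^ 2 / 2) := by
    intro i j
    rw [cliqueSqDist, cliqueSqDist, sqDist_avgStep, imbalance_avgStep]
    simp only [side, Sum.elim_inl]; ring
  have hr : ∀ i j : Fin n, cliqueSqDist (avgStep s(.inr i, .inr j) v) - cliqueSqDist v
      = -((v (.inr i) - v (.inr j)) ^ 2 / 2) := by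
    intro i j
    rw [cliqueSqDist, cliqueSqDist, sqDist_avgStep, imbalance_avgStep]
    simp only [side, Sum.elim_inr]; ring
  have hb : cliqueSqDist (avgStep s(.inl p, .inr p) v) - cliqueSqDist v
      ≤ 1 / (2 * (n : ℝ) ^ 2) := by
    rw [cliqueSqDist, cliqueSqDist, sqDist_avgStep, imbalance_avgStep]
    simp only [side, Sum.elim_inl, Sum.elim_inr]
    set D := v (.inl p) - v (.inr p)
    set d := imbalance v
    -- Completing the square in `D` leaves `d ^ 2 / (2 * n ^ 2)` as the only positive term.
    have e1 : sqDist v - D ^ 2 / 2 - (d - (1 - -1) * D / 2) ^ 2 / (2 * n) - (sqDist v - d ^ 2 / (2 * n))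
        = d ^ 2 * (1 / (2 * (n : ℝ) ^ 2)) - (D - d / n) ^ 2 / 2 - D ^ 2 / (2 * n) := by
      field_simp
      ring
    rw [e1]
    have e2 : d ^ 2 * (1 / (2 * (n : ℝ) ^ 2)) ≤ 1 * (1 / (2 * (n : ℝ) ^ 2)) := by gcongr
    have e3 : 0 ≤ D ^ 2 / (2 * n) := by positivity
    nlinarith [sq_nonneg (D - d / n)]
  simp only [hl, hr, sum_neg_distrib, ← sum_div] at h
  set I := ∫ e, cliqueSqDist (avgStep e v) ∂(uniformOn (dumbbell n).edgeSet)
  set X := cliqueSqDist v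
  set N := numEdges n
  set B := 1 / (2 * (n : ℝ) ^ 2)
  have hB : 0 < B := by positivity
  have h2 : 2 * N * (I - X) ≤ -(n * X) + 2 * B := by linarith
  have h3 : 2 * N * (X / (2 * n)) ≤ n * X := by
    calc 2 * N * (X / (2 * n)) ≤ 2 * (n : ℝ) ^ 2 * (X / (2 * n)) := by gcongr
      _ = n * X := by field_simp
  have h4 : 2 * B ≤ 2 * N * B := by nlinarith
  have h5 : 2 * N * (I - X) ≤ 2 * N * (B - X / (2 * n)) := by
    rw [mul_sub (2 * N) B]; linarith
  have h6 := le_of_mul_le_mul_left h5 (by positivity)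
  have h7 : (1 - 1 / (2 * n)) * X + B = X + (B - X / (2 * n)) := by ring
  rw [h7]
  linarith

lemma sqDist_drift_le (hn : 1 ≤ n) (v : Fin n ⊕ Fin n → ℝ) :
    ∫ e, sqDist (avgStep e v) ∂(uniformOn (dumbbell n).edgeSet)
      ≤ (1 - 1 / (8 * (n : ℝ) ^ 3)) * sqDist v := by
  have hn1 : (1 : ℝ) ≤ n := by exact_mod_cast hn
  have hp : ((⟨n - 1, by omega⟩ : Fin n) : ℕ) + 1 = n := by simp; omega
  have h := two_mul_numEdges_mul_drift hp sqDist v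
  have hX := cliqueSqDist_nonneg hn v
  have hN1 := one_le_numEdges hn
  have hN2 := numEdges_le hn
  set p : Fin n := ⟨n - 1, by omega⟩
  have hsum := sum_sum_sub_sq_add hn v
  have hδ := bridge_sub_sq_le p v
  have hl : ∀ i j, sqDist (avgStep s(i, j) v) - sqDist v = -((v i - v j) ^ 2 / 2) := by
    intro i j
    rw [sqDist_avgStep]; ring
  simp only [hl, sum_neg_distrib, ← sum_div] at h
  have hS : sqDist v = cliqueSqDist v + imbalance v ^ 2 / (2 * n) := by rw [cliqueSqDist]; ring
  have hS0 : 0 ≤ sqDist v := by rw [hS]; positivity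
  set I := ∫ e, sqDist (avgStep e v) ∂(uniformOn (dumbbell n).edgeSet)
  set X := cliqueSqDist v
  set N := numEdges n
  set D := v (.inl p) - v (.inr p)
  have h2 : 2 * N * (I - sqDist v) = -(n * X + D ^ 2) := by linarith
  -- Spectral gap: either `D` is comparable to `imbalance v / n`, or their discrepancy is paid for
  -- by `X` through `hδ`.
  have h3 : sqDist v / (4 * n) ≤ n * X + D ^ 2 := by
    have e1 : sqDist v / (4 * n) = X / (4 * n) + (imbalance v / n) ^ 2 / 8 := by
      rw [hS]; field_simp; ring
    have e2 : X / (4 * n) ≤ X / 4 := by gcongr; linarith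
    have e3 : X ≤ n * X := by nlinarith
    rw [e1]
    nlinarith [sq_nonneg (2 * (D - imbalance v / n) + imbalance v / n), sq_nonneg D]
  have h4 : 2 * N * (sqDist v / (8 * (n : ℝ) ^ 3)) ≤ sqDist v / (4 * n) := by
    calc 2 * N * (sqDist v / (8 * (n : ℝ) ^ 3))
        ≤ 2 * (n : ℝ) ^ 2 * (sqDist v / (8 * (n : ℝ) ^ 3)) := by gcongr
      _ = sqDist v / (4 * n) := by field_simp; ring
  have h5 : 2 * N * (I - sqDist v) ≤ 2 * N * (-(sqDist v / (8 * (n : ℝ) ^ 3))) := by linarith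
  have h6 := le_of_mul_le_mul_left h5 (by positivity)
  have h7 : (1 - 1 / (8 * (n : ℝ) ^ 3)) * sqDist v = sqDist v - sqDist v / (8 * (n : ℝ) ^ 3) := by
    ring
  rw [h7]
  linarith

lemma sqDist_le_sq_l1Norm (v : Fin n ⊕ Fin n → ℝ) : sqDist v ≤ l1Norm v ^ 2 := by
  have h : ∑ x, |v x| ^ 2 ≤ (∑ x, |v x|) ^ 2 := sum_sq_le_sq_sum_of_nonneg fun x _ => abs_nonneg _
  simp only [sq_abs] at h
  have : 0 ≤ (∑ x, v x) ^ 2 / (2 * n) := by positivity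
  unfold sqDist l1Norm
  linarith

/-- The term `1 / n` is the fixed point of the affine drift bound. -/
lemma integral_cliqueSqDist_le (hn : 1 ≤ n) {v₀ : Fin n ⊕ Fin n → ℝ} (h₀ : l1Norm v₀ = 1) (t : ℕ) :
    ∫ ω, cliqueSqDist (state v₀ ω t) ∂(edgeLaw (dumbbell n)) ≤ (1 - 1 / (2 * n)) ^ t + 1 / n := by
  have hn1 : (1 : ℝ) ≤ n := by exact_mod_cast hn
  have hG := dumbbell_edgeSet_nonempty hn
  have := isProbabilityMeasure_edgeLaw hG
  have hc : (0 : ℝ) ≤ 1 - 1 / (2 * n) := by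
    rw [sub_nonneg, div_le_one (by positivity)]; linarith
  induction t with
  | zero =>
    have h1 : cliqueSqDist v₀ ≤ 1 := by
      have h2 := sqDist_le_sq_l1Norm v₀
      rw [h₀] at h2
      have : 0 ≤ imbalance v₀ ^ 2 / (2 * n) := by positivity
      unfold cliqueSqDist
      linarith
    have : (0 : ℝ) ≤ 1 / n := by positivity
    simp only [state, integral_const, probReal_univ, smul_eq_mul, one_mul, pow_zero]
    linarith
  | succ t ih =>
    calc _ ≤ _ := integral_state_succ_le hG (P := fun v => l1Norm v ≤ 1)
          (fun e v hv => (l1Norm_avgStep_le e v).trans hv) h₀.le cliqueSqDist _ _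
          (cliqueSqDist_drift_le hn) t
      _ ≤ (1 - 1 / (2 * n)) * ((1 - 1 / (2 * n)) ^ t + 1 / n) + 1 / (2 * (n : ℝ) ^ 2) := by gcongr
      _ = (1 - 1 / (2 * n)) ^ (t + 1) + 1 / n := by
        have : (1 - 1 / (2 * n)) * (1 / n) + 1 / (2 * (n : ℝ) ^ 2) = 1 / n := by field_simp; ring
        rw [pow_succ' (1 - 1 / (2 * (n : ℝ))), mul_add]
        linarith

lemma one_sub_pow_le_exp {x : ℝ} (hx : x ≤ 1) (k : ℕ) : (1 - x) ^ k ≤ Real.exp (-(k * x)) := by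
  calc (1 - x) ^ k ≤ Real.exp (-x) ^ k := by
        gcongr
        exact Real.one_sub_le_exp_neg x
    _ = _ := by rw [← Real.exp_nat_mul]; ring_nf

lemma integral_sqDist_le_of_phase (hn : 1 ≤ n) {v₀ : Fin n ⊕ Fin n → ℝ} (h₀ : l1Norm v₀ = 1) :
    ∫ ω, sqDist (state v₀ ω (2 * n ^ 2)) ∂(edgeLaw (dumbbell n)) ≤ 5 / (2 * n) := by
  have hn1 : (1 : ℝ) ≤ n := by exact_mod_cast hn
  have hG := dumbbell_edgeSet_nonempty hn
  have := isProbabilityMeasure_edgeLaw hG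
  have h1 := integral_cliqueSqDist_le hn h₀ (2 * n ^ 2)
  -- The burn-in length makes this at most `exp (-n)`.
  have h2 : (1 - 1 / (2 * n) : ℝ) ^ (2 * n ^ 2) ≤ 1 / n := by
    have hx : (1 : ℝ) / (2 * n) ≤ 1 := by rw [div_le_one (by positivity)]; linarith
    refine (one_sub_pow_le_exp hx _).trans ?_
    have e1 : ((2 * n ^ 2 : ℕ) : ℝ) * (1 / (2 * n)) = n := by push_cast; field_simp
    rw [e1, Real.exp_neg, ← one_div]
    gcongr
    linarith [Real.add_one_le_exp (n : ℝ)]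
  calc _ ≤ ∫ ω, cliqueSqDist (state v₀ ω (2 * n ^ 2)) + 1 / (2 * n) ∂(edgeLaw (dumbbell n)) := by
        apply integral_mono (integrable_state hG _ _ _)
          ((integrable_state hG _ _ _).add (integrable_const _))
        intro ω
        have hP : l1Norm (state v₀ ω (2 * n ^ 2)) ≤ 1 :=
          state_invariant (P := fun v => l1Norm v ≤ 1)
            (fun e v hv => (l1Norm_avgStep_le e v).trans hv) h₀.le ω _
        have hd : imbalance (state v₀ ω (2 * n ^ 2)) ^ 2 ≤ 1 := by
          rw [sq_le_one_iff_abs_le_one]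
          exact (abs_imbalance_le _).trans hP
        have : imbalance (state v₀ ω (2 * n ^ 2)) ^ 2 / (2 * n) ≤ 1 / (2 * n) := by gcongr
        simp only [cliqueSqDist, Pi.add_apply]
        linarith
    _ = (∫ ω, cliqueSqDist (state v₀ ω (2 * n ^ 2)) ∂(edgeLaw (dumbbell n))) + 1 / (2 * n) := by
        rw [integral_add (integrable_state hG _ _ _) (integrable_const _)]; simp
    _ ≤ 1 / n + 1 / n + 1 / (2 * n) := by linarith
    _ = 5 / (2 * n) := by field_simp; norm_num

lemma integral_sqDist_le (hn : 1 ≤ n) {v₀ : Fin n ⊕ Fin n → ℝ} (h₀ : l1Norm v₀ = 1) (s : ℕ) :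
    ∫ ω, sqDist (state v₀ ω (2 * n ^ 2 + s)) ∂(edgeLaw (dumbbell n))
      ≤ (1 - 1 / (8 * (n : ℝ) ^ 3)) ^ s * (5 / (2 * n)) := by
  have hn1 : (1 : ℝ) ≤ n := by exact_mod_cast hn
  have hc : (0 : ℝ) ≤ 1 - 1 / (8 * (n : ℝ) ^ 3) := by
    have : (1 : ℝ) ≤ (n : ℝ) ^ 3 := one_le_pow₀ hn1
    rw [sub_nonneg, div_le_one (by positivity)]; linarith
  induction s with
  | zero => simpa using integral_sqDist_le_of_phase hn h₀
  | succ s ih =>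
    have h := integral_state_succ_le (dumbbell_edgeSet_nonempty hn) (P := fun _ => True)
      (fun _ _ _ => trivial) (v₀ := v₀) trivial sqDist (1 - 1 / (8 * (n : ℝ) ^ 3)) 0
      (fun v _ => by simpa using sqDist_drift_le hn v) (2 * n ^ 2 + s)
    rw [add_zero] at h
    rw [pow_succ' (1 - 1 / (8 * (n : ℝ) ^ 3)), mul_assoc]
    exact h.trans (by gcongr)

/-! ### From squared distance to `L¹`: the upper bound. -/

lemma l1Norm_sub_meanVec_sq_le (hn : 1 ≤ n) {v v₀ : Fin n ⊕ Fin n → ℝ}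
    (h : ∑ x, v x = ∑ x, v₀ x) : l1Norm (v - meanVec v₀) ^ 2 ≤ 2 * n * sqDist v := by
  have hn0 : (n : ℝ) ≠ 0 := by positivity
  have h1 := sq_sum_le_card_mul_sum_sq (s := univ) (f := fun x => |v x - meanVec v₀ x|)
  have hcard : (Fintype.card (Fin n ⊕ Fin n) : ℝ) = 2 * n := by
    simp only [Fintype.card_sum, Fintype.card_fin]; push_cast; ring
  have h2 : ∑ x, |v x - meanVec v₀ x| ^ 2 = sqDist v := by
    simp only [meanVec, sq_abs, sub_sq, sum_add_distrib, sum_sub_distrib, ← mul_sum, ← sum_mul,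
      sum_const, card_univ, nsmul_eq_mul, hcard, ← h, sqDist]
    field_simp
    ring
  rw [h2, card_univ, hcard] at h1
  exact h1

lemma expectedL1Dist_le (hn : 1 ≤ n) {ε : ℝ} (hε : 0 < ε) (v₀ : Fin n ⊕ Fin n → ℝ) (t : ℕ) :
    expectedL1Dist (dumbbell n) v₀ t
      ≤ ε / 2 + n / ε * ∫ ω, sqDist (state v₀ ω t) ∂(edgeLaw (dumbbell n)) := by
  have hG := dumbbell_edgeSet_nonempty hn
  have := isProbabilityMeasure_edgeLaw hG
  calc expectedL1Dist (dumbbell n) v₀ t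
      ≤ ∫ ω, ε / 2 + n / ε * sqDist (state v₀ ω t) ∂(edgeLaw (dumbbell n)) := by
        apply integral_mono (integrable_state hG v₀ t fun v => l1Norm (v - meanVec v₀))
          ((integrable_const _).add ((integrable_state hG v₀ t sqDist).const_mul _))
        intro ω
        have hs : ∑ x, state v₀ ω t x = ∑ x, v₀ x :=
          state_invariant (P := fun v => ∑ x, v x = ∑ x, v₀ x)
            (fun e v hv => (sum_avgStep_eq e v).trans hv) rfl ω t
        have h1 := l1Norm_sub_meanVec_sq_le hn hs
        set y := l1Norm (state v₀ ω t - meanVec v₀)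
        -- Young's inequality stands in for Cauchy-Schwarz under the expectation.
        have h2 : y ≤ ε / 2 + y ^ 2 / (2 * ε) := by
          have : ε / 2 + y ^ 2 / (2 * ε) - y = (y - ε) ^ 2 / (2 * ε) := by field_simp; ring
          have : 0 ≤ (y - ε) ^ 2 / (2 * ε) := by positivity
          linarith
        calc y ≤ ε / 2 + y ^ 2 / (2 * ε) := h2
          _ ≤ ε / 2 + 2 * n * sqDist (state v₀ ω t) / (2 * ε) := by gcongr
          _ = ε / 2 + n / ε * sqDist (state v₀ ω t) := by field_simp
    _ = _ := by
        rw [integral_add (integrable_const _) ((integrable_state hG v₀ t sqDist).const_mul _),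
          integral_const_mul]
        simp

lemma mem_mixedTimes_dumbbell (hn : 1 ≤ n) {ε : ℝ} (hε : 0 < ε) {s : ℕ}
    (hs : 8 * (n : ℝ) ^ 3 * Real.log (5 / ε ^ 2) ≤ s) :
    2 * n ^ 2 + s ∈ mixedTimes ε (dumbbell n) := by
  intro v₀ h₀
  have hn1 : (1 : ℝ) ≤ n := by exact_mod_cast hn
  have hn3 : (1 : ℝ) ≤ (n : ℝ) ^ 3 := one_le_pow₀ hn1
  have hx : 1 / (8 * (n : ℝ) ^ 3) ≤ 1 := by rw [div_le_one (by positivity)]; linarith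
  -- The target `ε ^ 2 / 5` turns the burn-in bound `5 / (2 * n)` into a contribution of `ε / 2`.
  have hpow : (1 - 1 / (8 * (n : ℝ) ^ 3)) ^ s ≤ ε ^ 2 / 5 := by
    refine (one_sub_pow_le_exp hx s).trans ?_
    have h1 : Real.log (5 / ε ^ 2) ≤ s * (1 / (8 * (n : ℝ) ^ 3)) := by
      rw [mul_one_div, le_div_iff₀ (by positivity)]; linarith
    calc Real.exp (-(s * (1 / (8 * (n : ℝ) ^ 3)))) ≤ Real.exp (-Real.log (5 / ε ^ 2)) := by
          gcongr
      _ = ε ^ 2 / 5 := by rw [Real.exp_neg, Real.exp_log (by positivity), inv_div]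
  calc expectedL1Dist (dumbbell n) v₀ (2 * n ^ 2 + s)
      ≤ ε / 2 + n / ε * ((1 - 1 / (8 * (n : ℝ) ^ 3)) ^ s * (5 / (2 * n))) := by
        refine (expectedL1Dist_le hn hε v₀ _).trans ?_
        gcongr
        exact integral_sqDist_le hn h₀ s
    _ ≤ ε / 2 + n / ε * (ε ^ 2 / 5 * (5 / (2 * n))) := by gcongr
    _ = ε := by field_simp; norm_num

/-! ### The lower bound. -/

/-- The uniform distribution on the first clique. -/
noncomputable def uniformLeft (n : ℕ) : Fin n ⊕ Fin n → ℝ := Sum.elim (fun _ => 1 / n) fun _ => 0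

lemma l1Norm_uniformLeft (hn : 1 ≤ n) : l1Norm (uniformLeft n) = 1 := by
  have : (n : ℝ) ≠ 0 := by positivity
  simp [l1Norm, uniformLeft, this]

lemma imbalance_uniformLeft (hn : 1 ≤ n) : imbalance (uniformLeft n) = 1 := by
  have : (n : ℝ) ≠ 0 := by positivity
  simp [imbalance_eq, uniformLeft, this]

lemma imbalance_le_l1Norm_sub_meanVec (v v₀ : Fin n ⊕ Fin n → ℝ) :
    imbalance v ≤ l1Norm (v - meanVec v₀) := by
  have h : imbalance v = imbalance (v - meanVec v₀) := by
    simp [imbalance_eq, meanVec]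
  rw [h]
  exact (le_abs_self _).trans (abs_imbalance_le _)

/-- Only the bridge moves mass between the cliques. The sign is reversed so that
`integral_state_succ_le` bounds the imbalance from below. -/
lemma imbalance_drift (hn : 1 ≤ n) (v : Fin n ⊕ Fin n → ℝ)
    (hv : ∀ x, v x ∈ Set.Icc 0 (1 / (n : ℝ))) :
    ∫ e, -imbalance (avgStep e v) ∂(uniformOn (dumbbell n).edgeSet)
      ≤ 1 * -imbalance v + 1 / (n * numEdges n) := by
  have hn0 : (0 : ℝ) < n := by positivity
  have hp : ((⟨n - 1, by omega⟩ : Fin n) : ℕ) + 1 = n := by simp; omega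
  have h := two_mul_numEdges_mul_drift hp (fun v => -imbalance v) v
  have hN := one_le_numEdges hn
  set p : Fin n := ⟨n - 1, by omega⟩
  have hD : v (.inl p) - v (.inr p) ≤ 1 / n := by linarith [(hv (.inl p)).2, (hv (.inr p)).1]
  simp only [imbalance_avgStep, side, Sum.elim_inl, Sum.elim_inr, sub_self, zero_mul, zero_div,
    sub_zero, sum_const_zero, zero_add] at h
  set I := ∫ e, -imbalance (avgStep e v) ∂(uniformOn (dumbbell n).edgeSet)
  have h2 : numEdges n * (I - -imbalance v) ≤ numEdges n * (1 / (n * numEdges n)) := by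
    have : numEdges n * (1 / (n * numEdges n)) = 1 / n := by field_simp
    rw [this]
    linarith
  have h3 := le_of_mul_le_mul_left h2 (by positivity)
  linarith

lemma one_sub_le_expectedL1Dist (hn : 1 ≤ n) (t : ℕ) :
    1 - t * (1 / (n * numEdges n)) ≤ expectedL1Dist (dumbbell n) (uniformLeft n) t := by
  have hG := dumbbell_edgeSet_nonempty hn
  have := isProbabilityMeasure_edgeLaw hG
  have hinv : ∀ x, uniformLeft n x ∈ Set.Icc 0 (1 / (n : ℝ)) := by
    rintro (x | x) <;> simp [uniformLeft]
  have h1 : ∫ ω, -imbalance (state (uniformLeft n) ω t) ∂(edgeLaw (dumbbell n))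
      ≤ -1 + t * (1 / (n * numEdges n)) := by
    induction t with
    | zero => simp [state, imbalance_uniformLeft hn]
    | succ t ih =>
      have := integral_state_succ_le hG (P := fun v => ∀ x, v x ∈ Set.Icc 0 (1 / (n : ℝ)))
        (fun e v hv => avgStep_mem_Icc e v hv) hinv (fun v => -imbalance v) _ _
        (imbalance_drift hn) t
      push_cast
      linarith
  rw [integral_neg] at h1
  have h2 : ∫ ω, imbalance (state (uniformLeft n) ω t) ∂(edgeLaw (dumbbell n))
      ≤ expectedL1Dist (dumbbell n) (uniformLeft n) t :=
    integral_mono (integrable_state hG _ t imbalance)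
      (integrable_state hG _ t fun v => l1Norm (v - meanVec (uniformLeft n)))
      fun ω => imbalance_le_l1Norm_sub_meanVec _ _
  linarith

lemma le_of_mem_mixedTimes_dumbbell (hn : 1 ≤ n) {ε : ℝ} (hε : ε < 1) {t : ℕ}
    (ht : t ∈ mixedTimes ε (dumbbell n)) : (1 - ε) / 2 * (n : ℝ) ^ 3 ≤ t := by
  have hn0 : (0 : ℝ) < n := by positivity
  have hN := one_le_numEdges hn
  have h := (one_sub_le_expectedL1Dist hn t).trans (ht _ (l1Norm_uniformLeft hn))
  have h1 : 1 - ε ≤ t / (n * numEdges n) := by rw [div_eq_mul_one_div]; linarith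
  rw [le_div_iff₀ (by positivity)] at h1
  calc (1 - ε) / 2 * (n : ℝ) ^ 3 = (1 - ε) / 2 * (n * (n : ℝ) ^ 2) := by ring
    _ ≤ (1 - ε) / 2 * (n * (2 * numEdges n)) := by
        gcongr
        exact sq_le_two_mul_numEdges n
    _ = (1 - ε) * (n * numEdges n) := by ring
    _ ≤ t := h1

end Dumbbell

end AveragingProcess

theorem mainTheorem5 (ε : ℝ) (hε0 : 0 < ε) (hε1 : ε < 1) :
    ∃ c C : ℝ, 0 < c ∧ 0 < C ∧ ∀ n : ℕ, 1 ≤ n →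
      (AveragingProcess.mixedTimes ε (AveragingProcess.dumbbell n)).Nonempty ∧
      c * (n : ℝ) ^ 3 ≤ (AveragingProcess.mixingTime ε (AveragingProcess.dumbbell n) : ℝ) ∧
      (AveragingProcess.mixingTime ε (AveragingProcess.dumbbell n) : ℝ) ≤ C * (n : ℝ) ^ 3 := by
  have hlog : 0 ≤ Real.log (5 / ε ^ 2) := by
    apply Real.log_nonneg
    rw [le_div_iff₀ (by positivity)]
    nlinarith
  refine ⟨(1 - ε) / 2, 3 + 8 * Real.log (5 / ε ^ 2), by linarith, by linarith, fun n hn => ?_⟩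
  have hn1 : (1 : ℝ) ≤ n := by exact_mod_cast hn
  have hmem := AveragingProcess.mem_mixedTimes_dumbbell hn hε0
    (Nat.le_ceil (8 * (n : ℝ) ^ 3 * Real.log (5 / ε ^ 2)))
  -- Nonemptiness makes `sInf` an attained minimum, not the default `0`. The `3` in the upper
  -- constant absorbs `2 * n ^ 2` and the rounding of the ceiling.
  refine ⟨⟨_, hmem⟩, AveragingProcess.le_of_mem_mixedTimes_dumbbell hn hε1 (Nat.sInf_mem ⟨_, hmem⟩),
    (Nat.cast_le.2 (Nat.sInf_le hmem)).trans ?_⟩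
  have h1 := Nat.ceil_lt_add_one (a := 8 * (n : ℝ) ^ 3 * Real.log (5 / ε ^ 2)) (by positivity)
  have h2 : (n : ℝ) ^ 2 ≤ (n : ℝ) ^ 3 := pow_le_pow_right₀ hn1 (by norm_num)
  have h3 : (1 : ℝ) ≤ (n : ℝ) ^ 3 := one_le_pow₀ hn1
  push_cast
  linarith
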